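/- Let $n\ge 2$, $\theta>0$ and $0\le\phi\le\pi/2$. Let $S^{n-1}$ be the unit sphere of $\mathbb{R}^n$, $e_n=(0,\dots,0,1)$, and $\mathrm{Cap}(n,\phi)=\{x\in S^{n-1}:\langle x,e_n\rangle\ge\cos\phi\}$. A $\theta$-code in a set $Z\subseteq S^{n-1}$ is a finite subset of $Z$ any two distinct points of which are at angular distance at least $\theta$. Let $A(n,\theta)$ and $A(n,\theta,\phi)$ be the maximum size of a $\theta$-code in $S^{n-1}$ and in $\mathrm{Cap}(n,\phi)$, respectively. Let $G_k^{(n)}$ ($k=0,1,\dots$) be the Gegenbauer polynomials: $G_k^{(n)}$ has degree $k$, the $G_k^{(n)}$ are pairwise orthogonal on $[-1,1]$ with weight $(1-x^2)^{(n-3)/2}$, and $G_k^{(n)}(1)=1$. For a real function $f$ on $[-1,1]$ and a $\theta$-code $Y=\{y_1,\dots,y_m\}$ in $\mathrm{Cap}(n,\phi)$ put $$H_f(Y)=f(1)+\sum_{i=1}^m f(\langle -e_n,y_i\rangle),$$ let $h_m(n,\theta,\phi,f)$ be the maximum of $H_f(Y)$ over all $\theta$-codes $Y$ in $\mathrm{Cap}(n,\phi)$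 with exactly $m$ points, and let $$h_{\max}(n,\theta,\phi,f)=\max_{0\le m\le A(n,\theta,\phi)}h_m(n,\theta,\phi,f).$$ Suppose that $f(t)=\sum_{k\ge 0}f_kG_k^{(n)}(t)$ for all $t\in[-1,1]$ (a finite sum or a convergent series), where $f_k\ge 0$ for all $k$ and $f_0>0$, and that $f(t)\le 0$ for all $t\in[-\cos\phi,\cos\theta]$. Then the maxima defining $A(n,\theta)$, $A(n,\theta,\phi)$ and $h_m(n,\theta,\phi,f)$ for $0\le m\le A(n,\theta,\phi)$ exist, and $$A(n,\theta)\le\frac{h_{\max}(n,\theta,\phi,f)}{f_0}.$$ -/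

import Mathlib

noncomputable section

namespace CapCodes

open Polynomial

/-- The Gegenbauer polynomials `G_k^{(n)}`, `n ≥ 2`, normalized by `G_k^{(n)}(1) = 1`, through
their three-term recurrence. That they are the polynomials of degree `k` orthogonal on `[-1, 1]`
with weight `(1 - x²)^((n-3)/2)` is proved in `gegenbauer_natDegree`, `gegenbauer_eval_one`
and `gegenbauer_orthogonal` below. -/
def gegenbauer (n : ℕ) : ℕ → ℝ[X]
  | 0 => 1
  | 1 => X
  | k + 2 => C ((k : ℝ) + n - 1)⁻¹ *
      (C (2 * (k : ℝ) + n) * X * gegenbauer n (k + 1) - C ((k : ℝ) + 1) * gegenbauer n k)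

theorem gegenbauer_rec (n : ℕ) (hn : 2 ≤ n) (k : ℕ) :
    ((k : ℝ[X]) + (n : ℝ[X]) - 1) * gegenbauer n (k + 2) =
      (2 * (k : ℝ[X]) + (n : ℝ[X])) * X * gegenbauer n (k + 1) - ((k : ℝ[X]) + 1) * gegenbauer n k := by
  have hn' : (2 : ℝ) ≤ n := by exact_mod_cast hn
  have h0 : ((k : ℝ) + n - 1) ≠ 0 := by
    have : (0 : ℝ) ≤ k := k.cast_nonneg
    linarith
  have h1 : ((k : ℝ[X]) + (n : ℝ[X]) - 1) = C ((k : ℝ) + n - 1) := by simp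
  rw [gegenbauer, h1, ← mul_assoc, ← C_mul, mul_inv_cancel₀ h0]
  simp only [C_1, one_mul, C_add, C_mul, map_natCast, map_ofNat]

theorem gegenbauer_eval_one (n : ℕ) (hn : 2 ≤ n) (k : ℕ) : (gegenbauer n k).eval 1 = 1 := by
  have hn' : (2 : ℝ) ≤ n := by exact_mod_cast hn
  induction k using Nat.twoStepInduction with
  | zero => simp [gegenbauer]
  | one => simp [gegenbauer]
  | more k h1 h2 =>
    have h0 : ((k : ℝ) + n - 1) ≠ 0 := by
      have : (0 : ℝ) ≤ k := k.cast_nonneg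
      linarith
    simp only [gegenbauer, eval_mul, eval_sub, eval_C, eval_X, h1, h2]
    field_simp
    ring

theorem gegenbauer_degree_aux (n : ℕ) (hn : 2 ≤ n) (k : ℕ) :
    (gegenbauer n k).natDegree ≤ k ∧ 0 < (gegenbauer n k).coeff k := by
  have hn' : (2 : ℝ) ≤ n := by exact_mod_cast hn
  induction k using Nat.twoStepInduction with
  | zero => simp [gegenbauer]
  | one => simp [gegenbauer]
  | more k h1 h2 =>
    have hk : (0 : ℝ) ≤ k := k.cast_nonneg
    have h0 : 0 < ((k : ℝ) + n - 1) := by linarith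
    have hc : (gegenbauer n k).coeff (k + 2) = 0 :=
      coeff_eq_zero_of_natDegree_lt (by omega)
    constructor
    · rw [gegenbauer]
      refine (natDegree_C_mul_le _ _).trans ((natDegree_sub_le _ _).trans (max_le ?_ ?_))
      · rw [mul_assoc]
        refine (natDegree_C_mul_le _ _).trans (natDegree_mul_le.trans ?_)
        rw [natDegree_X]
        omega
      · exact (natDegree_C_mul_le _ _).trans (by omega)
    · rw [gegenbauer, coeff_C_mul, coeff_sub, coeff_C_mul, hc, mul_assoc, coeff_C_mul,
        coeff_X_mul]
      have := h2.2
      have h3 : 0 < 2 * (k : ℝ) + n := by linarith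
      simp only [mul_zero, sub_zero]
      positivity

theorem gegenbauer_natDegree (n : ℕ) (hn : 2 ≤ n) (k : ℕ) : (gegenbauer n k).natDegree = k := by
  obtain ⟨h1, h2⟩ := gegenbauer_degree_aux n hn k
  exact le_antisymm h1 (le_natDegree_of_ne_zero h2.ne')

/-- `(1 - t²) G_{k+1}' = (k+1) (G_k - t G_{k+1})`. -/
theorem gegenbauer_derivative (n : ℕ) (hn : 2 ≤ n) (k : ℕ) :
    (1 - X ^ 2) * derivative (gegenbauer n (k + 1)) =
      ((k : ℝ[X]) + 1) * (gegenbauer n k - X * gegenbauer n (k + 1)) ∧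
    (1 - X ^ 2) * derivative (gegenbauer n k) =
      ((k : ℝ[X]) + (n : ℝ[X]) - 2) * (X * gegenbauer n k - gegenbauer n (k + 1)) := by
  induction k with
  | zero =>
    constructor
    · simp [gegenbauer]; ring
    · simp [gegenbauer]
  | succ k ih =>
    obtain ⟨h1, h2⟩ := ih
    have hr := gegenbauer_rec n hn k
    have hn' : (2 : ℝ) ≤ n := by exact_mod_cast hn
    have h0 : ((k : ℝ[X]) + (n : ℝ[X]) - 1) ≠ 0 := by
      have h1 : ((k : ℝ[X]) + (n : ℝ[X]) - 1) = C ((k : ℝ) + n - 1) := by simp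
      rw [h1, Ne, C_eq_zero]
      have : (0 : ℝ) ≤ k := k.cast_nonneg
      linarith
    have hd := congrArg derivative hr
    simp only [derivative_mul, derivative_sub, derivative_add, derivative_natCast,
      derivative_one, derivative_X, derivative_ofNat] at hd
    constructor
    · apply mul_left_cancel₀ h0
      push_cast
      linear_combination (1 - X ^ 2) * hd + (2 * (k : ℝ[X]) + (n : ℝ[X])) * X * h1 -
        ((k : ℝ[X]) + 1) * h2 + (((k : ℝ[X]) + 2) * X) * hr
    · push_cast
      linear_combination h1 + hr

/-- The Gegenbauer differential equation. -/
theorem gegenbauer_ode (n : ℕ) (hn : 2 ≤ n) (k : ℕ) :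
    (1 - X ^ 2) * derivative (derivative (gegenbauer n k)) =
      ((n : ℝ[X]) - 1) * X * derivative (gegenbauer n k) -
        (k : ℝ[X]) * ((k : ℝ[X]) + (n : ℝ[X]) - 2) * gegenbauer n k := by
  cases k with
  | zero => simp [gegenbauer]
  | succ k =>
    obtain ⟨h1, h2⟩ := gegenbauer_derivative n hn k
    have hd := congrArg derivative h1
    simp only [derivative_mul, derivative_sub, derivative_add, derivative_natCast,
      derivative_one, derivative_X, derivative_pow] at hd
    have h0 : (1 - X ^ 2 : ℝ[X]) ≠ 0 := by
      intro h
      have := congrArg (eval 0) h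
      simp at this
    apply mul_left_cancel₀ h0
    push_cast at hd ⊢
    rw [map_ofNat] at hd
    linear_combination (1 - X ^ 2) * hd + (2 - (k : ℝ[X]) - (n : ℝ[X])) * X * h1 +
      ((k : ℝ[X]) + 1) * h2

theorem weight_intervalIntegrable (n : ℕ) (hn : 2 ≤ n) :
    IntervalIntegrable (fun x : ℝ => (1 - x ^ 2) ^ (((n : ℝ) - 3) / 2)) MeasureTheory.volume
      (-1) 1 := by
  rcases hn.eq_or_lt with rfl | hn
  · have h : IntervalIntegrable (fun x : ℝ => 1 / √(1 - x ^ 2)) MeasureTheory.volume (-1) 1 := by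
      refine intervalIntegral.intervalIntegrable_deriv_of_nonneg (g := Real.arcsin)
        Real.continuous_arcsin.continuousOn ?_ ?_
      · intro x hx
        rw [min_eq_left (by norm_num), max_eq_right (by norm_num)] at hx
        exact Real.hasDerivAt_arcsin hx.1.ne' hx.2.ne
      · intro x _
        positivity
    refine h.congr ?_
    intro x hx
    rw [Set.uIoc_of_le (by norm_num)] at hx
    have h0 : 0 ≤ 1 - x ^ 2 := by nlinarith [hx.1, hx.2]
    have h2 : (((2 : ℕ) : ℝ) - 3) / 2 = -(1 / 2) := by norm_num
    simp only [h2]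
    rw [Real.rpow_neg h0, ← Real.sqrt_eq_rpow, one_div]
  · have h3 : (3 : ℝ) ≤ n := by exact_mod_cast hn
    have hc : Continuous (fun x : ℝ => (1 - x ^ 2) ^ (((n : ℝ) - 3) / 2)) :=
      (continuous_const.sub (continuous_pow 2)).rpow_const (fun x => Or.inr (by linarith))
    exact hc.intervalIntegrable _ _

theorem gegenbauer_orthogonal (n : ℕ) (hn : 2 ≤ n) {k l : ℕ} (hkl : k ≠ l) :
    ∫ x in (-1 : ℝ)..1, (gegenbauer n k).eval x * (gegenbauer n l).eval x *
      (1 - x ^ 2) ^ (((n : ℝ) - 3) / 2) = 0 := by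
  have hn' : (2 : ℝ) ≤ n := by exact_mod_cast hn
  set P := gegenbauer n k with hP
  set Q := gegenbauer n l with hQ
  set a : ℝ := ((n : ℝ) - 3) / 2 with ha
  set c : ℝ := (l : ℝ) * (l + n - 2) - k * (k + n - 2) with hc
  have hc0 : c ≠ 0 := by
    have h1 : c = ((l : ℝ) - k) * (l + k + n - 2) := by rw [hc]; ring
    rw [h1]
    refine mul_ne_zero (sub_ne_zero.2 (by exact_mod_cast hkl.symm)) ?_
    have h2 : (1 : ℝ) ≤ l + k := by
      have : 1 ≤ l + k := by omega
      exact_mod_cast this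
    linarith
  have hode (m : ℕ) (x : ℝ) := congrArg (eval x) (gegenbauer_ode n hn m)
  simp only [eval_mul, eval_sub, eval_add, eval_pow, eval_X, eval_natCast, eval_one,
    eval_ofNat] at hode
  have hint : IntervalIntegrable
      (fun x : ℝ => c * (P.eval x * Q.eval x * (1 - x ^ 2) ^ a)) MeasureTheory.volume (-1) 1 := by
    refine IntervalIntegrable.const_mul ?_ c
    exact (weight_intervalIntegrable n hn).continuousOn_mul
      (P.continuous.mul Q.continuous).continuousOn
  have hcont : ContinuousOn (fun x : ℝ => (1 - x ^ 2) ^ (a + 1) *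
      (P.derivative.eval x * Q.eval x - P.eval x * Q.derivative.eval x)) (Set.Icc (-1) 1) := by
    refine Continuous.continuousOn (Continuous.mul ?_ ?_)
    · exact (continuous_const.sub (continuous_pow 2)).rpow_const
        (fun x => Or.inr (by rw [ha]; linarith))
    · exact (P.derivative.continuous.mul Q.continuous).sub
        (P.continuous.mul Q.derivative.continuous)
  have hderiv : ∀ x ∈ Set.Ioo (-1 : ℝ) 1, HasDerivAt (fun x : ℝ => (1 - x ^ 2) ^ (a + 1) *
      (P.derivative.eval x * Q.eval x - P.eval x * Q.derivative.eval x))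
      (c * (P.eval x * Q.eval x * (1 - x ^ 2) ^ a)) x := by
    intro x hx
    have h0 : 0 < 1 - x ^ 2 := by nlinarith [hx.1, hx.2]
    have h1 : HasDerivAt (fun x : ℝ => 1 - x ^ 2) (-(2 * x)) x := by
      simpa using (hasDerivAt_pow 2 x).const_sub 1
    have h2 := h1.rpow_const (p := a + 1) (Or.inl h0.ne')
    have h3 := ((P.derivative.hasDerivAt x).mul (Q.hasDerivAt x)).sub
      ((P.hasDerivAt x).mul (Q.derivative.hasDerivAt x))
    refine (h2.mul h3).congr_deriv ?_
    have h4 : (1 - x ^ 2) ^ (a + 1) = (1 - x ^ 2) ^ a * (1 - x ^ 2) := Real.rpow_add_one h0.ne' a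
    have h5 : a + 1 - 1 = a := by ring
    have hk := hode k x
    have hl := hode l x
    have h6 : 2 * (a + 1) = (n : ℝ) - 1 := by rw [ha]; ring
    rw [← hP] at hk
    rw [← hQ] at hl
    simp only [Pi.mul_apply, Pi.sub_apply, h4, h5, hc]
    linear_combination (1 - x ^ 2) ^ a * Q.eval x * hk - (1 - x ^ 2) ^ a * P.eval x * hl -
      (1 - x ^ 2) ^ a * x *
        (P.derivative.eval x * Q.eval x - P.eval x * Q.derivative.eval x) * h6
  have hftc := intervalIntegral.integral_eq_sub_of_hasDerivAt_of_le (by norm_num) hcont hderiv hint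
  rw [intervalIntegral.integral_const_mul] at hftc
  have h7 : a + 1 ≠ 0 := by rw [ha]; intro h; linarith
  have h8 : (1 - (1 : ℝ) ^ 2) ^ (a + 1) = 0 := by norm_num [Real.zero_rpow h7]
  have h9 : (1 - (-1 : ℝ) ^ 2) ^ (a + 1) = 0 := by norm_num [Real.zero_rpow h7]
  rw [h8, h9, zero_mul, zero_mul, sub_zero] at hftc
  exact (mul_eq_zero.1 hftc).resolve_left hc0

/-- The north pole `e_n = (0, …, 0, 1)`. -/
def northPole (n : ℕ) : EuclideanSpace ℝ (Fin n) :=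
  WithLp.toLp 2 (fun i => if (i : ℕ) + 1 = n then 1 else 0)

/-- The strip `Z(n, [ψ, φ])` on the unit sphere of `ℝⁿ`. -/
def strip (n : ℕ) (ψ φ : ℝ) : Set (EuclideanSpace ℝ (Fin n)) :=
  {x | ‖x‖ = 1 ∧ Real.cos φ ≤ inner ℝ x (northPole n) ∧ inner ℝ x (northPole n) ≤ Real.cos ψ}

/-- The spherical cap `Cap(n, φ)`. -/
def cap (n : ℕ) (φ : ℝ) : Set (EuclideanSpace ℝ (Fin n)) := strip n 0 φ

/-- `C` is a `θ`-code in the subset `Z` of the sphere: a finite subset whose distinct points are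
at angular distance at least `θ`. -/
def IsCode {n : ℕ} (θ : ℝ) (Z : Set (EuclideanSpace ℝ (Fin n)))
    (C : Finset (EuclideanSpace ℝ (Fin n))) : Prop :=
  (C : Set (EuclideanSpace ℝ (Fin n))) ⊆ Z ∧
    ∀ x ∈ C, ∀ y ∈ C, x ≠ y → θ ≤ InnerProductGeometry.angle x y

/-- The sizes of the `θ`-codes in `Z`. -/
def codeSizes {n : ℕ} (θ : ℝ) (Z : Set (EuclideanSpace ℝ (Fin n))) : Set ℕ :=
  {m | ∃ C, IsCode θ Z C ∧ C.card = m}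

/-- `A(n, θ, φ)`, the maximum size of a `θ`-code in `Cap(n, φ)`. -/
def maxCapCode (n : ℕ) (θ φ : ℝ) : ℕ := sSup (codeSizes θ (cap n φ))

/-- `A(n, θ)`, the maximum size of a `θ`-code in the unit sphere `S^{n-1}`. -/
def maxSphericalCode (n : ℕ) (θ : ℝ) : ℕ :=
  sSup (codeSizes θ (Metric.sphere (0 : EuclideanSpace ℝ (Fin n)) 1))

/-- `H_f(Y) = f(1) + ∑_{y ∈ Y} f(⟨-e_n, y⟩)`. -/
def H (n : ℕ) (f : ℝ → ℝ) (Y : Finset (EuclideanSpace ℝ (Fin n))) : ℝ :=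
  f 1 + ∑ y ∈ Y, f (inner ℝ (-northPole n) y)

/-- The values `H_f(Y)` at the `θ`-codes `Y` in `Cap(n, φ)` with exactly `m` points. -/
def hValues (n : ℕ) (θ φ : ℝ) (f : ℝ → ℝ) (m : ℕ) : Set ℝ :=
  {v | ∃ Y, IsCode θ (cap n φ) Y ∧ Y.card = m ∧ H n f Y = v}

/-- `h_m(n, θ, φ, f)`, the maximum of `H_f` over the `m`-point `θ`-codes in `Cap(n, φ)`. -/
def h (n : ℕ) (θ φ : ℝ) (f : ℝ → ℝ) (m : ℕ) : ℝ := sSup (hValues n θ φ f m)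

/-- `h_max(n, θ, φ, f)`, the maximum of `h_m(n, θ, φ, f)` over `0 ≤ m ≤ A(n, θ, φ)`. -/
def hMax (n : ℕ) (θ φ : ℝ) (f : ℝ → ℝ) : ℝ :=
  (Finset.range (maxCapCode n θ φ + 1)).sup' Finset.nonempty_range_add_one (h n θ φ f)

end CapCodes

end

/-!
Every Gegenbauer polynomial is positive definite on the sphere (Schoenberg): `G_k(⟨y, z⟩)` is the
value at `z` of a harmonic homogeneous polynomial `Z_y` of degree `k`, and the Fischer inner
product with `Z_y` is, up to a positive constant, evaluation at `y` on all such polynomials, so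
that `G_k(⟨y, z⟩)` is a positive multiple of the Fischer inner product of `Z_y` and `Z_z`. Summing
the expansion of `f` over the pairs of points of a `θ`-code `C` in the sphere, only the constant
term need be kept, and `f_0 |C|² ≤ ∑_{x, y ∈ C} f(⟨x, y⟩)`. Conversely, for fixed `x ∈ C`, the sign
condition on `f` leaves in `∑_{y ∈ C} f(⟨x, y⟩)` only the term `f(1)` and those of the points `y`
in the cap of angular radius `φ` around `-x`; a rotation taking `-x` to `e_n` bounds the sum by
`h_max`.
-/

namespace CapCodes

section PolynomialCalculus

open MvPolynomial

variable {σ R : Type*} [CommRing R]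

theorem pderiv_pderiv_comm (i j : σ) (p : MvPolynomial σ R) :
    pderiv i (pderiv j p) = pderiv j (pderiv i p) := by
  classical
  have hcomm : ⁅pderiv (R := R) i, pderiv j⁆ = 0 := derivation_ext fun l => by
    rw [Derivation.commutator_apply, pderiv_X, pderiv_X]
    simp only [Pi.single_apply]
    split_ifs <;> simp
  rw [← sub_eq_zero, ← Derivation.commutator_apply, hcomm, Derivation.zero_apply]

variable [Fintype σ]

/-- The linear form `⟨y, X⟩ = ∑ i, y i X i`, the zonal harmonic of degree one with pole `y`. -/
noncomputable def linearForm (y : σ → R) : MvPolynomial σ R := ∑ i, y i • X i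

variable (σ R) in
/-- The quadratic form `|X|² = ∑ i, (X i)²`, by which the Gegenbauer recurrence is homogenized. -/
noncomputable def normSqForm : MvPolynomial σ R := ∑ i, X i ^ 2

/-- The derivative of polynomials in the direction `y`, the Fischer adjoint of `⟨y, X⟩`. -/
noncomputable def dirDeriv (y : σ → R) : Derivation R (MvPolynomial σ R) (MvPolynomial σ R) :=
  ∑ i, y i • pderiv i

variable (σ R) in
/-- The Laplacian of polynomials, the Fischer adjoint of `|X|²`. -/
noncomputable def laplacian : MvPolynomial σ R →ₗ[R] MvPolynomial σ R :=
  ∑ i, (pderiv i).toLinearMap ∘ₗ (pderiv i).toLinearMap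

theorem dirDeriv_apply (y : σ → R) (p : MvPolynomial σ R) :
    dirDeriv y p = ∑ i, y i • pderiv i p := by
  have h := congrFun
    (map_sum Derivation.coeFnAddMonoidHom (fun i => y i • pderiv (R := R) i) Finset.univ) p
  rwa [Finset.sum_apply] at h

theorem laplacian_apply (p : MvPolynomial σ R) :
    laplacian σ R p = ∑ i, pderiv i (pderiv i p) := by
  simp [laplacian]

theorem isHomogeneous_linearForm (y : σ → R) : (linearForm y).IsHomogeneous 1 :=
  (homogeneousSubmodule σ R 1).sum_mem fun i _ =>
    (homogeneousSubmodule σ R 1).smul_mem (y i) (isHomogeneous_X R i)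

theorem isHomogeneous_normSqForm : (normSqForm σ R).IsHomogeneous 2 :=
  IsHomogeneous.sum _ _ _ fun i _ => isHomogeneous_X_pow i 2

theorem isHomogeneous_dirDeriv (y : σ → R) {p : MvPolynomial σ R} {k : ℕ}
    (hp : p.IsHomogeneous (k + 1)) : (dirDeriv y p).IsHomogeneous k := by
  rw [dirDeriv_apply]
  exact (homogeneousSubmodule σ R k).sum_mem fun i _ =>
    (homogeneousSubmodule σ R k).smul_mem (y i) hp.pderiv

theorem eval_linearForm (y z : σ → R) : eval z (linearForm y) = y ⬝ᵥ z := by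
  simp [linearForm, dotProduct, smul_eval]

theorem eval_normSqForm (z : σ → R) : eval z (normSqForm σ R) = z ⬝ᵥ z := by
  simp [normSqForm, dotProduct, pow_two]

theorem eval_dirDeriv_self {p : MvPolynomial σ R} {k : ℕ} (hp : p.IsHomogeneous k) (y : σ → R) :
    eval y (dirDeriv y p) = k * eval y p := by
  simpa [dirDeriv_apply, smul_eval] using congrArg (eval y) hp.sum_X_mul_pderiv

theorem pderiv_linearForm (y : σ → R) (i : σ) : pderiv i (linearForm y) = C (y i) := by
  classical simp [linearForm, pderiv_X, Pi.single_apply, smul_eq_C_mul]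

theorem pderiv_normSqForm (i : σ) : pderiv i (normSqForm σ R) = 2 * X i := by
  classical simp [normSqForm, pderiv_X, Pi.single_apply]

theorem dirDeriv_linearForm (y z : σ → R) : dirDeriv y (linearForm z) = C (y ⬝ᵥ z) := by
  simp [dirDeriv_apply, pderiv_linearForm, dotProduct, smul_eq_C_mul]

theorem dirDeriv_normSqForm (y : σ → R) :
    dirDeriv y (normSqForm σ R) = (2 : R) • linearForm y := by
  simp [dirDeriv_apply, pderiv_normSqForm, linearForm, Finset.smul_sum, smul_eq_C_mul,
    mul_left_comm, map_ofNat]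

theorem laplacian_dirDeriv (y : σ → R) (p : MvPolynomial σ R) :
    laplacian σ R (dirDeriv y p) = dirDeriv y (laplacian σ R p) := by
  simp only [laplacian_apply, dirDeriv_apply, map_sum, Derivation.map_smul]
  rw [Finset.sum_comm]
  refine Finset.sum_congr rfl fun i _ => Finset.sum_congr rfl fun j _ => ?_
  rw [pderiv_pderiv_comm i j p, pderiv_pderiv_comm i j]

theorem laplacian_linearForm_mul (y : σ → R) (p : MvPolynomial σ R) :
    laplacian σ R (linearForm y * p) = 2 * dirDeriv y p + linearForm y * laplacian σ R p := by
  simp only [laplacian_apply, dirDeriv_apply, Finset.mul_sum, ← Finset.sum_add_distrib]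
  refine Finset.sum_congr rfl fun i _ => ?_
  simp only [pderiv_mul, pderiv_linearForm, map_add, pderiv_C, smul_eq_C_mul]
  ring

theorem laplacian_normSqForm_mul {p : MvPolynomial σ R} {k : ℕ} (hp : p.IsHomogeneous k) :
    laplacian σ R (normSqForm σ R * p) =
      (2 * (2 * (k : R) + Fintype.card σ)) • p + normSqForm σ R * laplacian σ R p := by
  have pderiv_two (i : σ) : pderiv i (2 : MvPolynomial σ R) = 0 := (pderiv i).map_natCast 2
  have leibniz (i : σ) : pderiv i (pderiv i (normSqForm σ R * p)) =
      2 * p + 4 * (X i * pderiv i p) + normSqForm σ R * pderiv i (pderiv i p) := by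
    simp only [pderiv_mul, pderiv_normSqForm, map_add, pderiv_X_self, pderiv_two]
    ring
  simp only [laplacian_apply, leibniz, Finset.sum_add_distrib, ← Finset.mul_sum,
    hp.sum_X_mul_pderiv, Finset.sum_const, Finset.card_univ, nsmul_eq_mul, smul_eq_C_mul, C_mul,
    C_add, map_natCast, map_ofNat]
  ring

end PolynomialCalculus

section Fischer

open MvPolynomial

variable {σ R : Type*} [Fintype σ] [CommRing R]

variable (σ R) in
/-- The Fischer inner product `∑ α, α! p_α q_α` of polynomials, for which multiplication by a
variable and the corresponding partial derivative are adjoint. -/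
noncomputable def fischer : MvPolynomial σ R →ₗ[R] MvPolynomial σ R →ₗ[R] R :=
  (basisMonomials σ R).constr R fun α => (∏ i, ((α i).factorial : R)) • lcoeff R α

theorem fischer_monomial (α : σ →₀ ℕ) (c : R) (q : MvPolynomial σ R) :
    fischer σ R (monomial α c) q = c * ((∏ i, ((α i).factorial : R)) * coeff α q) := by
  have h : monomial α c = c • basisMonomials σ R α := by simp [smul_monomial]
  rw [h, map_smul, fischer, Module.Basis.constr_basis]
  simp

theorem fischer_apply (p q : MvPolynomial σ R) :
    fischer σ R p q =
      ∑ α ∈ p.support, coeff α p * ((∏ i, ((α i).factorial : R)) * coeff α q) := by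
  conv_lhs => rw [p.as_sum]
  simp only [map_sum, LinearMap.sum_apply, fischer_monomial]

theorem fischer_one (q : MvPolynomial σ R) : fischer σ R 1 q = coeff 0 q := by
  simpa using fischer_monomial 0 1 q

theorem prod_factorial_single_add (i : σ) (α : σ →₀ ℕ) :
    ∏ j, ((Finsupp.single i 1 + α : σ →₀ ℕ) j).factorial = (α i + 1) * ∏ j, (α j).factorial := by
  classical
  rw [← Finset.mul_prod_erase _ _ (Finset.mem_univ i),
    ← Finset.mul_prod_erase _ (fun j => (α j).factorial) (Finset.mem_univ i), ← mul_assoc]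
  congr 1
  · simp [add_comm 1, Nat.factorial_succ]
  · refine Finset.prod_congr rfl fun j hj => ?_
    simp [(Finset.ne_of_mem_erase hj).symm]

theorem fischer_X_mul (i : σ) (p q : MvPolynomial σ R) :
    fischer σ R (X i * p) q = fischer σ R p (pderiv i q) := by
  induction p using MvPolynomial.induction_on' with
  | monomial α c =>
    have hfactorial : (∏ j, (((Finsupp.single i 1 + α : σ →₀ ℕ) j).factorial : R)) =
        (α i + 1) * ∏ j, ((α j).factorial : R) := by
      exact_mod_cast congrArg (Nat.cast : ℕ → R) (prod_factorial_single_add i α)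
    rw [X, monomial_mul, one_mul, fischer_monomial, fischer_monomial, coeff_pderiv, hfactorial,
      add_comm (Finsupp.single i 1)]
    ring
  | add p p' hp hp' => rw [mul_add, map_add, map_add, LinearMap.add_apply, LinearMap.add_apply,
      hp, hp']

theorem fischer_linearForm_mul (y : σ → R) (p q : MvPolynomial σ R) :
    fischer σ R (linearForm y * p) q = fischer σ R p (dirDeriv y q) := by
  simp only [linearForm, dirDeriv_apply, Finset.sum_mul, smul_mul_assoc, map_sum, map_smul,
    LinearMap.sum_apply, LinearMap.smul_apply, fischer_X_mul]

theorem fischer_normSqForm_mul (p q : MvPolynomial σ R) :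
    fischer σ R (normSqForm σ R * p) q = fischer σ R p (laplacian σ R q) := by
  simp only [normSqForm, laplacian_apply, Finset.sum_mul, pow_two, mul_assoc, map_sum,
    LinearMap.sum_apply, fischer_X_mul]

theorem fischer_self_nonneg (p : MvPolynomial σ ℝ) : 0 ≤ fischer σ ℝ p p := by
  rw [fischer_apply]
  refine Finset.sum_nonneg fun α _ => ?_
  rw [mul_left_comm]
  exact mul_nonneg (by positivity) (mul_self_nonneg _)

end Fischer

section Zonal

open MvPolynomial

variable {n : ℕ}

/-- The zonal harmonic of degree `k` with pole `y`, the homogenization `|X|^k G_k(⟨y, X⟩ / |X|)` of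
the Gegenbauer polynomial, defined through the homogenized recurrence. -/
noncomputable def zonal (y : Fin n → ℝ) : ℕ → MvPolynomial (Fin n) ℝ
  | 0 => 1
  | 1 => linearForm y
  | k + 2 => ((k : ℝ) + n - 1)⁻¹ •
      ((2 * (k : ℝ) + n) • (linearForm y * zonal y (k + 1)) -
        ((k : ℝ) + 1) • (normSqForm (Fin n) ℝ * zonal y k))

theorem isHomogeneous_zonal (y : Fin n → ℝ) (k : ℕ) : (zonal y k).IsHomogeneous k := by
  induction k using Nat.twoStepInduction with
  | zero => exact isHomogeneous_one _ _
  | one => exact isHomogeneous_linearForm y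
  | more k ih₀ ih₁ =>
    have hlinear := (isHomogeneous_linearForm y).mul ih₁
    have hnormSq := isHomogeneous_normSqForm.mul ih₀
    rw [show 1 + (k + 1) = k + 2 by omega] at hlinear
    rw [add_comm 2 k] at hnormSq
    let V := homogeneousSubmodule (Fin n) ℝ (k + 2)
    exact V.smul_mem _ (V.sub_mem (V.smul_mem _ hlinear) (V.smul_mem _ hnormSq))

theorem eval_zonal (y : Fin n → ℝ) {z : Fin n → ℝ} (hz : z ⬝ᵥ z = 1) (k : ℕ) :
    eval z (zonal y k) = (gegenbauer n k).eval (y ⬝ᵥ z) := by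
  induction k using Nat.twoStepInduction with
  | zero => simp [zonal, gegenbauer]
  | one => simp [zonal, gegenbauer, eval_linearForm]
  | more k ih₀ ih₁ =>
    simp only [zonal, gegenbauer, smul_eval, map_mul, map_sub, eval_linearForm, eval_normSqForm, hz,
      ih₀, ih₁, Polynomial.eval_mul, Polynomial.eval_sub, Polynomial.eval_C, Polynomial.eval_X]
    ring

-- For `k = 0` the truncated index `k - 1` is harmless, its coefficient being zero.
theorem smul_zonal_succ (hn : 2 ≤ n) (y : Fin n → ℝ) (k : ℕ) :
    ((k : ℝ) + n - 2) • zonal y (k + 1) =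
      (2 * (k : ℝ) + n - 2) • (linearForm y * zonal y k) -
        (k : ℝ) • (normSqForm (Fin n) ℝ * zonal y (k - 1)) := by
  have hn' : (2 : ℝ) ≤ n := by exact_mod_cast hn
  cases k with
  | zero => simp [zonal]
  | succ k =>
    have hne : (k : ℝ) + n - 1 ≠ 0 := by linarith [(k.cast_nonneg : (0 : ℝ) ≤ k)]
    rw [Nat.add_sub_cancel, zonal, smul_smul]
    push_cast
    rw [show ((k : ℝ) + 1 + n - 2) * ((k : ℝ) + n - 1)⁻¹ = 1 by field_simp; ring]
    module

theorem dirDeriv_zonal (hn : 2 ≤ n) {y : Fin n → ℝ} (hy : y ⬝ᵥ y = 1) (k : ℕ) :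
    dirDeriv y (zonal y k) = (k : ℝ) • zonal y (k - 1) := by
  have hn' : (2 : ℝ) ≤ n := by exact_mod_cast hn
  induction k using Nat.twoStepInduction with
  | zero => simp [zonal]
  | one => simp [zonal, dirDeriv_linearForm, hy]
  | more k ih₀ ih₁ =>
    have hne : (k : ℝ) + n - 1 ≠ 0 := by linarith [(k.cast_nonneg : (0 : ℝ) ≤ k)]
    rw [Nat.add_sub_cancel] at ih₁
    rw [zonal, Derivation.map_smul, inv_smul_eq_iff₀ hne]
    simp only [map_sub, Derivation.map_smul, Derivation.leibniz, dirDeriv_linearForm, hy,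
      dirDeriv_normSqForm, ih₀, ih₁, smul_eq_mul, mul_smul_comm, smul_mul_assoc,
      mul_comm (zonal y k), C_1, mul_one, Nat.add_one_sub_one]
    push_cast
    linear_combination (norm := module) (-((k : ℝ) + 1)) • smul_zonal_succ hn y k

theorem laplacian_zonal (hn : 2 ≤ n) {y : Fin n → ℝ} (hy : y ⬝ᵥ y = 1) (k : ℕ) :
    laplacian (Fin n) ℝ (zonal y k) = 0 := by
  induction k using Nat.twoStepInduction with
  | zero => simp [zonal, laplacian_apply]
  | one => simp [zonal, laplacian_apply, pderiv_linearForm]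
  | more k ih₀ ih₁ =>
    rw [zonal, map_smul, map_sub, map_smul, map_smul, laplacian_linearForm_mul,
      laplacian_normSqForm_mul (isHomogeneous_zonal y k), ih₀, ih₁, dirDeriv_zonal hn hy,
      Fintype.card_fin, Nat.add_sub_cancel]
    simp only [smul_eq_C_mul, Nat.cast_add, Nat.cast_one, C_mul, C_add, C_1, map_natCast, map_ofNat]
    ring

theorem exists_fischer_zonal_succ (hn : 2 ≤ n) (k : ℕ) : ∃ c : ℝ, 0 < c ∧
    ∀ (y : Fin n → ℝ) (q : MvPolynomial (Fin n) ℝ), laplacian (Fin n) ℝ q = 0 →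
      fischer _ ℝ (zonal y (k + 1)) q = c * fischer _ ℝ (zonal y k) (dirDeriv y q) := by
  cases k with
  | zero =>
    refine ⟨1, one_pos, fun y q _ => ?_⟩
    rw [zonal, zonal, one_mul, ← fischer_linearForm_mul, mul_one]
  | succ k =>
    have hn' : (2 : ℝ) ≤ n := by exact_mod_cast hn
    have hpos : 0 < (k : ℝ) + n - 1 := by linarith [(k.cast_nonneg : (0 : ℝ) ≤ k)]
    refine ⟨((k : ℝ) + n - 1)⁻¹ * (2 * (k : ℝ) + n), by positivity, fun y q hq => ?_⟩
    simp only [zonal, map_smul, map_sub, LinearMap.smul_apply, LinearMap.sub_apply,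
      fischer_linearForm_mul, fischer_normSqForm_mul, hq, map_zero, smul_eq_mul]
    ring

theorem exists_fischer_zonal_eq_mul_eval (hn : 2 ≤ n) (k : ℕ) : ∃ c : ℝ, 0 < c ∧
    ∀ (y : Fin n → ℝ) (q : MvPolynomial (Fin n) ℝ), q.IsHomogeneous k →
      laplacian (Fin n) ℝ q = 0 → fischer _ ℝ (zonal y k) q = c * eval y q := by
  induction k with
  | zero =>
    refine ⟨1, one_pos, fun y q hq _ => ?_⟩
    rw [zonal, fischer_one, one_mul, totalDegree_eq_zero_iff_eq_C.1
      (Nat.le_zero.1 hq.totalDegree_le), coeff_zero_C, eval_C]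
  | succ k ih =>
    obtain ⟨c, hc, hfischer⟩ := ih
    obtain ⟨d, hd, hsucc⟩ := exists_fischer_zonal_succ hn k
    refine ⟨d * (c * ((k : ℝ) + 1)), by positivity, fun y q hq hharm => ?_⟩
    have hharm' : laplacian (Fin n) ℝ (dirDeriv y q) = 0 := by
      rw [laplacian_dirDeriv, hharm, map_zero]
    rw [hsucc y q hharm, hfischer y _ (isHomogeneous_dirDeriv y hq) hharm', eval_dirDeriv_self hq]
    push_cast
    ring

end Zonal

section PositiveDefinite

theorem posSemidef_gegenbauer_inner {n : ℕ} (hn : 2 ≤ n) (k : ℕ) {ι : Type*}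
    (x : ι → EuclideanSpace ℝ (Fin n)) (hx : ∀ i, ‖x i‖ = 1) :
    (Matrix.of fun i j => (gegenbauer n k).eval (inner ℝ (x i) (x j))).PosSemidef := by
  obtain ⟨c, hc, hfischer⟩ := exists_fischer_zonal_eq_mul_eval hn k
  have hunit (i : ι) : (x i).ofLp ⬝ᵥ (x i).ofLp = 1 := by
    simpa [hx i] using (EuclideanSpace.inner_eq_star_dotProduct (x i) (x i)).symm
  have hgram (i j : ι) : fischer _ ℝ (zonal (x i) k) (zonal (x j) k) =
      c * (gegenbauer n k).eval (inner ℝ (x j) (x i)) := by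
    rw [hfischer _ _ (isHomogeneous_zonal _ k) (laplacian_zonal hn (hunit j) k),
      eval_zonal _ (hunit i), real_inner_comm,
      EuclideanSpace.inner_eq_star_dotProduct, star_trivial]
  refine ⟨Matrix.ext fun i j => by simp [real_inner_comm], fun w => ?_⟩
  refine nonneg_of_mul_nonneg_right ?_ hc
  have h := fischer_self_nonneg (w.sum fun i wi => wi • zonal (x i) k)
  simp only [Finsupp.sum, map_sum, map_smul, LinearMap.sum_apply, LinearMap.smul_apply, hgram,
    smul_eq_mul] at h
  simpa [Finsupp.sum, Finset.mul_sum, mul_assoc, mul_comm, mul_left_comm] using h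

theorem sum_gegenbauer_inner_nonneg {n : ℕ} (hn : 2 ≤ n) (k : ℕ)
    {C : Finset (EuclideanSpace ℝ (Fin n))} (hC : ∀ x ∈ C, ‖x‖ = 1) :
    0 ≤ ∑ x ∈ C, ∑ y ∈ C, (gegenbauer n k).eval (inner ℝ x y) := by
  have h := (posSemidef_gegenbauer_inner hn k ((↑) : C → EuclideanSpace ℝ (Fin n))
    fun x => hC x x.2).dotProduct_mulVec_nonneg 1
  simpa [dotProduct, Matrix.mulVec, Finset.sum_coe_sort C fun _ => (gegenbauer n k).eval _,
    ← Finset.sum_coe_sort C] using h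

theorem exists_norm_eq_one_inner_eq {n : ℕ} (hn : 2 ≤ n) {t : ℝ} (ht : t ∈ Set.Icc (-1 : ℝ) 1) :
    ∃ x y : EuclideanSpace ℝ (Fin n), ‖x‖ = 1 ∧ ‖y‖ = 1 ∧ inner ℝ x y = t := by
  have hrank : 1 < Module.rank ℝ (EuclideanSpace ℝ (Fin n)) := by
    rw [← Module.finrank_eq_rank, finrank_euclideanSpace_fin]
    exact_mod_cast hn
  have : Nonempty (Fin n) := ⟨⟨0, by omega⟩⟩
  obtain ⟨x, hx⟩ :=
    NormedSpace.sphere_nonempty (x := (0 : EuclideanSpace ℝ (Fin n))).2 zero_le_one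
  rw [mem_sphere_zero_iff_norm] at hx
  obtain ⟨y, hy, hxy⟩ := (isPreconnected_sphere hrank 0 1).intermediate_value
    (f := fun y => inner ℝ x y) (by simpa : -x ∈ _) (by simpa : x ∈ _) (by fun_prop)
    (by simpa [hx] using ht)
  exact ⟨x, y, hx, mem_sphere_zero_iff_norm.1 hy, hxy⟩

theorem abs_eval_gegenbauer_le_one {n : ℕ} (hn : 2 ≤ n) (k : ℕ) {t : ℝ}
    (ht : t ∈ Set.Icc (-1 : ℝ) 1) : |(gegenbauer n k).eval t| ≤ 1 := by
  obtain ⟨x, y, hx, hy, rfl⟩ := exists_norm_eq_one_inner_eq hn ht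
  have hdet := (posSemidef_gegenbauer_inner hn k ![x, y]
    fun i => by fin_cases i <;> simp [hx, hy]).det_nonneg
  simp only [Matrix.det_fin_two, Matrix.of_apply, Matrix.cons_val_zero, Matrix.cons_val_one,
    real_inner_self_eq_norm_sq, hx, hy, one_pow, gegenbauer_eval_one n hn,
    real_inner_comm x y] at hdet
  exact sq_le_one_iff_abs_le_one _ |>.1 (by linarith)

end PositiveDefinite

section Expansion

variable {n : ℕ} {f : ℝ → ℝ} {a : ℕ → ℝ}

theorem continuousOn_of_hasSum_gegenbauer (hn : 2 ≤ n) (ha : ∀ k, 0 ≤ a k)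
    (hf : ∀ t ∈ Set.Icc (-1 : ℝ) 1, HasSum (fun k => a k * (gegenbauer n k).eval t) (f t)) :
    ContinuousOn f (Set.Icc (-1) 1) := by
  have hsummable : Summable a := by
    simpa [gegenbauer_eval_one n hn] using (hf 1 (by norm_num)).summable
  refine (continuousOn_tsum (fun k => ?_) hsummable fun k t ht => ?_).congr
    fun t ht => (hf t ht).tsum_eq.symm
  · fun_prop
  · rw [norm_mul, Real.norm_eq_abs, abs_of_nonneg (ha k)]
    exact mul_le_of_le_one_right (ha k) (abs_eval_gegenbauer_le_one hn k ht)

theorem inner_mem_Icc_of_norm_eq_one {V : Type*} [NormedAddCommGroup V] [InnerProductSpace ℝ V]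
    {x y : V} (hx : ‖x‖ = 1) (hy : ‖y‖ = 1) : inner ℝ x y ∈ Set.Icc (-1 : ℝ) 1 :=
  abs_le.1 (by simpa [hx, hy] using abs_real_inner_le_norm x y)

theorem mul_card_sq_le_sum_inner (hn : 2 ≤ n) (ha : ∀ k, 0 ≤ a k)
    (hf : ∀ t ∈ Set.Icc (-1 : ℝ) 1, HasSum (fun k => a k * (gegenbauer n k).eval t) (f t))
    {C : Finset (EuclideanSpace ℝ (Fin n))} (hC : ∀ x ∈ C, ‖x‖ = 1) :
    a 0 * (C.card : ℝ) ^ 2 ≤ ∑ x ∈ C, ∑ y ∈ C, f (inner ℝ x y) := by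
  have hsum : HasSum (fun k => a k * ∑ x ∈ C, ∑ y ∈ C, (gegenbauer n k).eval (inner ℝ x y))
      (∑ x ∈ C, ∑ y ∈ C, f (inner ℝ x y)) := by
    simp only [Finset.mul_sum]
    exact hasSum_sum fun x hx => hasSum_sum fun y hy =>
      hf _ (inner_mem_Icc_of_norm_eq_one (hC x hx) (hC y hy))
  simpa [gegenbauer, pow_two] using
    le_hasSum hsum 0 fun k _ => mul_nonneg (ha k) (sum_gegenbauer_inner_nonneg hn k hC)

end Expansion

section Codes

open InnerProductGeometry Metric

theorem exists_finset_angle_lt {V : Type*} [NormedAddCommGroup V] [InnerProductSpace ℝ V]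
    [ProperSpace V] {θ : ℝ} (hθ : 0 < θ) :
    ∃ F : Finset V, ∀ x ∈ sphere (0 : V) 1, ∃ z ∈ F, angle x z < θ := by
  have hnhds : ∀ z ∈ sphere (0 : V) 1, {x | angle x z < θ} ∈ nhds z := fun z hz => by
    have hz₀ : z ≠ 0 := ne_zero_of_mem_unit_sphere ⟨z, hz⟩
    have hcont : ContinuousAt (fun x => angle x z) z :=
      (continuousAt_angle (x := (z, z)) hz₀ hz₀).comp (f := fun x => (x, z)) (by fun_prop)
    exact hcont.eventually_lt continuousAt_const (by rwa [angle_self hz₀])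
  obtain ⟨F, -, hF⟩ := (isCompact_sphere (0 : V) 1).elim_nhds_subcover _ hnhds
  exact ⟨F, fun x hx => by simpa using hF hx⟩

variable {n m : ℕ} {θ : ℝ} {Z : Set (EuclideanSpace ℝ (Fin n))}
  {C D : Finset (EuclideanSpace ℝ (Fin n))}

theorem isCode_empty : IsCode θ Z ∅ := ⟨by simp, by simp⟩

theorem IsCode.subset (hC : IsCode θ Z C) (hDC : D ⊆ C) : IsCode θ Z D :=
  ⟨(Finset.coe_subset.2 hDC).trans hC.1, fun x hx y hy => hC.2 x (hDC hx) y (hDC hy)⟩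

theorem IsCode.norm_eq_one (hC : IsCode θ (sphere 0 1) C) {x : EuclideanSpace ℝ (Fin n)}
    (hx : x ∈ C) : ‖x‖ = 1 :=
  mem_sphere_zero_iff_norm.1 (hC.1 hx)

theorem IsCode.inner_le_cos (hθ : 0 ≤ θ) (hC : IsCode θ (sphere 0 1) C)
    {x y : EuclideanSpace ℝ (Fin n)} (hx : x ∈ C) (hy : y ∈ C) (hxy : x ≠ y) :
    inner ℝ x y ≤ Real.cos θ := by
  rw [inner_eq_cos_angle_of_norm_eq_one (hC.norm_eq_one hx) (hC.norm_eq_one hy)]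
  exact Real.cos_le_cos_of_nonneg_of_le_pi hθ (angle_le_pi x y) (hC.2 x hx y hy hxy)

theorem bddAbove_codeSizes (hθ : 0 < θ) (hZ : Z ⊆ sphere 0 1) : BddAbove (codeSizes θ Z) := by
  obtain ⟨F, hF⟩ := exists_finset_angle_lt (V := EuclideanSpace ℝ (Fin n)) (half_pos hθ)
  choose! z hzF hz using hF
  refine ⟨F.card, ?_⟩
  rintro _ ⟨C, hC, rfl⟩
  refine Finset.card_le_card_of_injOn z (fun x hx => hzF x (hZ (hC.1 hx))) fun x hx y hy hxy => ?_
  by_contra hne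
  have htriangle := angle_le_angle_add_angle x (z x) y
  have hx' := hz x (hZ (hC.1 hx))
  have hy' := hz y (hZ (hC.1 hy))
  rw [← hxy, angle_comm] at hy'
  linarith [hC.2 x hx y hy hne]

theorem isGreatest_codeSizes (hθ : 0 < θ) (hZ : Z ⊆ sphere 0 1) :
    IsGreatest (codeSizes θ Z) (sSup (codeSizes θ Z)) :=
  ⟨Nat.sSup_mem ⟨0, ∅, isCode_empty, rfl⟩ (bddAbove_codeSizes hθ hZ),
    fun _ hm => le_csSup (bddAbove_codeSizes hθ hZ) hm⟩

/-- The enumerated `θ`-codes with `m` points in `Z`, as tuples: unlike the codes themselves, which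
are finite sets, they lie in a space whose topology makes them compact when `Z` is. -/
def orderedCodes {V : Type*} [NormedAddCommGroup V] [InnerProductSpace ℝ V] (θ : ℝ) (Z : Set V)
    (m : ℕ) : Set (Fin m → V) :=
  {y | (∀ i, y i ∈ Z) ∧ Pairwise fun i j => θ ≤ angle (y i) (y j)}

theorem isCompact_orderedCodes {V : Type*} [NormedAddCommGroup V] [InnerProductSpace ℝ V]
    (θ : ℝ) {Z : Set V} (hZ : IsCompact Z) (hZs : Z ⊆ sphere 0 1) (m : ℕ) :
    IsCompact (orderedCodes θ Z m) := by
  have hinner : orderedCodes θ Z m = (Set.univ.pi fun _ => Z) ∩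
      ⋂ (i) (j) (_ : i ≠ j), {y | θ ≤ Real.arccos (inner ℝ (y i) (y j))} := by
    ext y
    simp only [orderedCodes, Pairwise, Set.mem_ofPred_eq, Set.mem_inter_iff, Set.mem_pi,
      Set.mem_univ, true_imp_iff, Set.mem_iInter, angle]
    refine and_congr_right fun hy => forall₂_congr fun i j => ?_
    rw [mem_sphere_zero_iff_norm.1 (hZs (hy i)), mem_sphere_zero_iff_norm.1 (hZs (hy j)), mul_one,
      div_one]
  rw [hinner]
  refine (isCompact_univ_pi fun _ => hZ).inter_right <|
    isClosed_iInter fun i => isClosed_iInter fun j => isClosed_iInter fun _ => ?_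
  exact isClosed_le continuous_const (Real.continuous_arccos.comp (by fun_prop))

theorem injective_of_mem_orderedCodes {V : Type*} [NormedAddCommGroup V] [InnerProductSpace ℝ V]
    {θ : ℝ} (hθ : 0 < θ) {Z : Set V} (hZ : Z ⊆ sphere 0 1) {m : ℕ} {y : Fin m → V}
    (hy : y ∈ orderedCodes θ Z m) : Function.Injective y := by
  intro i j hij
  by_contra hne
  have h : θ ≤ angle (y i) (y j) := hy.2 hne
  rw [hij, angle_self (ne_zero_of_mem_unit_sphere ⟨_, hZ (hy.1 j)⟩)] at h
  exact h.not_gt hθ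

theorem isCode_and_card_eq_iff : IsCode θ Z C ∧ C.card = m ↔
    ∃ y ∈ orderedCodes θ Z m, ∃ hy : Function.Injective y, Finset.univ.map ⟨y, hy⟩ = C := by
  constructor
  · rintro ⟨hC, hm⟩
    let e := C.equivFinOfCardEq hm
    have hinj : Function.Injective fun i => (e.symm i : EuclideanSpace ℝ (Fin n)) :=
      Subtype.val_injective.comp e.symm.injective
    refine ⟨_, ⟨fun i => hC.1 (e.symm i).2, fun i j hij => ?_⟩, hinj, ?_⟩
    · exact hC.2 _ (e.symm i).2 _ (e.symm j).2 (hinj.ne hij)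
    · ext x
      simp [← e.symm.surjective.exists (p := fun z : C => (z : EuclideanSpace ℝ (Fin n)) = x)]
  · rintro ⟨y, ⟨hyZ, hy⟩, hinj, rfl⟩
    refine ⟨⟨by simpa [Set.range_subset_iff] using hyZ, ?_⟩, by simp⟩
    simp only [Finset.mem_map, Finset.mem_univ, true_and, Function.Embedding.coeFn_mk]
    rintro _ ⟨i, rfl⟩ _ ⟨j, rfl⟩ hij
    exact hy fun h => hij (congrArg y h)

end Codes

section Cap

open InnerProductGeometry Metric

variable {n m : ℕ} {θ φ : ℝ} {f : ℝ → ℝ}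

theorem norm_northPole (hn : n ≠ 0) : ‖northPole n‖ = 1 := by
  have h : northPole n = EuclideanSpace.single ⟨n - 1, by omega⟩ 1 := by
    ext i
    simp only [northPole, PiLp.single_apply, Fin.ext_iff]
    congr 1
    rw [eq_iff_iff]
    omega
  rw [h, PiLp.norm_single, norm_one]

theorem cap_subset_sphere : cap n φ ⊆ sphere 0 1 := fun _ hx => mem_sphere_zero_iff_norm.2 hx.1

theorem mem_cap_iff (hn : n ≠ 0) {x : EuclideanSpace ℝ (Fin n)} :
    x ∈ cap n φ ↔ ‖x‖ = 1 ∧ Real.cos φ ≤ inner ℝ x (northPole n) := by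
  refine ⟨fun hx => ⟨hx.1, hx.2.1⟩, fun hx => ⟨hx.1, hx.2, ?_⟩⟩
  simpa using (inner_mem_Icc_of_norm_eq_one hx.1 (norm_northPole hn)).2

theorem isCompact_cap : IsCompact (cap n φ) := by
  have h : cap n φ = sphere 0 1 ∩
      (fun x => inner ℝ x (northPole n)) ⁻¹' Set.Icc (Real.cos φ) (Real.cos 0) := by
    ext x
    simp [cap, strip]
  rw [h]
  exact (isCompact_sphere 0 1).inter_right (isClosed_Icc.preimage (by fun_prop))

theorem hValues_eq_image (hθ : 0 < θ) : hValues n θ φ f m =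
    (fun y => f 1 + ∑ i, f (inner ℝ (-northPole n) (y i))) '' orderedCodes θ (cap n φ) m := by
  ext v
  simp only [hValues, ← and_assoc, isCode_and_card_eq_iff, Set.mem_ofPred_eq, Set.mem_image]
  constructor
  · rintro ⟨_, ⟨y, hy, hinj, rfl⟩, rfl⟩
    exact ⟨y, hy, by simp [H]⟩
  · rintro ⟨y, hy, rfl⟩
    exact ⟨_, ⟨y, hy, injective_of_mem_orderedCodes hθ cap_subset_sphere hy, rfl⟩, by simp [H]⟩

theorem isGreatest_hValues (hn : n ≠ 0) (hθ : 0 < θ) (hf : ContinuousOn f (Set.Icc (-1) 1))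
    (hm : m ≤ maxCapCode n θ φ) : IsGreatest (hValues n θ φ f m) (h n θ φ f m) := by
  have hcompact : IsCompact (hValues n θ φ f m) := by
    rw [hValues_eq_image hθ]
    refine (isCompact_orderedCodes θ isCompact_cap cap_subset_sphere m).image_of_continuousOn
      (continuousOn_const.add (continuousOn_finsetSum _ fun i _ => ?_))
    refine hf.comp (by fun_prop) fun y hy => inner_mem_Icc_of_norm_eq_one ?_ (hy.1 i).1
    rw [norm_neg, norm_northPole hn]
  obtain ⟨C, hC, hcard⟩ := (isGreatest_codeSizes hθ (cap_subset_sphere (n := n) (φ := φ))).1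
  obtain ⟨Y, hYC, hY⟩ := Finset.exists_subset_card_eq (hm.trans_eq hcard.symm)
  exact hcompact.isGreatest_sSup ⟨_, Y, hC.subset hYC, hY, rfl⟩

theorem H_le_hMax (hn : n ≠ 0) (hθ : 0 < θ) (hf : ContinuousOn f (Set.Icc (-1) 1))
    {Y : Finset (EuclideanSpace ℝ (Fin n))} (hY : IsCode θ (cap n φ) Y) :
    H n f Y ≤ hMax n θ φ f := by
  have hcard : Y.card ≤ maxCapCode n θ φ :=
    (isGreatest_codeSizes hθ cap_subset_sphere).2 ⟨Y, hY, rfl⟩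
  calc H n f Y ≤ h n θ φ f Y.card := (isGreatest_hValues hn hθ hf hcard).2 ⟨Y, hY, rfl, rfl⟩
    _ ≤ hMax n θ φ f := Finset.le_sup' _ (Finset.mem_range_succ_iff.2 hcard)

end Cap

section Bound

open Metric

variable {n : ℕ} {θ φ s : ℝ} {f : ℝ → ℝ} {C : Finset (EuclideanSpace ℝ (Fin n))}
  {x : EuclideanSpace ℝ (Fin n)}

theorem sum_inner_le_add_sum_filter (hθ : 0 ≤ θ) (hs : s ≤ 1)
    (hneg : ∀ t ∈ Set.Icc s (Real.cos θ), f t ≤ 0) (hC : IsCode θ (sphere 0 1) C) (hx : x ∈ C) :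
    ∑ y ∈ C, f (inner ℝ x y) ≤ f 1 + ∑ y ∈ C with inner ℝ x y < s, f (inner ℝ x y) := by
  have hself : inner ℝ x x = 1 := by
    rw [real_inner_self_eq_norm_sq, hC.norm_eq_one hx, one_pow]
  rw [Finset.sum_filter, ← Finset.add_sum_erase C _ hx,
    ← Finset.add_sum_erase C (fun y => ite _ _ _) hx, hself, if_neg hs.not_gt, zero_add]
  gcongr with y hy
  split_ifs with hlt
  · exact le_rfl
  · obtain ⟨hne, hyC⟩ := Finset.mem_erase.1 hy
    exact hneg _ ⟨not_lt.1 hlt, hC.inner_le_cos hθ hx hyC hne.symm⟩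

theorem exists_isCode_cap_H_eq (hn : n ≠ 0) (hC : IsCode θ (sphere 0 1) C) (hx : ‖x‖ = 1)
    (φ : ℝ) (f : ℝ → ℝ) : ∃ Y, IsCode θ (cap n φ) Y ∧
      H n f Y = f 1 + ∑ y ∈ C with inner ℝ x y < -Real.cos φ, f (inner ℝ x y) := by
  obtain ⟨R, hR⟩ : ∃ R : EuclideanSpace ℝ (Fin n) ≃ₗᵢ[ℝ] EuclideanSpace ℝ (Fin n),
      R (-x) = northPole n :=
    ⟨_, Submodule.reflection_sub (by rw [norm_neg, hx, norm_northPole hn])⟩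
  refine ⟨(C.filter fun y => inner ℝ x y < -Real.cos φ).map R.toEquiv.toEmbedding,
    ⟨fun z hz => ?_, fun z hz w hw hzw => ?_⟩, ?_⟩
  · obtain ⟨y, hy, rfl⟩ := Finset.mem_map.1 hz
    obtain ⟨hyC, hlt⟩ := Finset.mem_filter.1 hy
    refine (mem_cap_iff hn).2 ⟨(R.norm_map y).trans (hC.norm_eq_one hyC), ?_⟩
    change Real.cos φ ≤ inner ℝ (R y) (northPole n)
    rw [← hR, R.inner_map_map, inner_neg_right, real_inner_comm]
    linarith
  · obtain ⟨y, hy, rfl⟩ := Finset.mem_map.1 hz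
    obtain ⟨y', hy', rfl⟩ := Finset.mem_map.1 hw
    refine (hC.2 y (Finset.mem_filter.1 hy).1 y' (Finset.mem_filter.1 hy').1 ?_).trans_eq
      (R.toLinearIsometry.angle_map y y').symm
    exact fun h => hzw (congrArg _ h)
  · rw [H, Finset.sum_map, ← hR, map_neg, neg_neg]
    exact congrArg _ (Finset.sum_congr rfl fun y _ => congrArg f (R.inner_map_map x y))

theorem sum_inner_le_hMax (hn : n ≠ 0) (hθ : 0 < θ) (hf : ContinuousOn f (Set.Icc (-1) 1))
    (hneg : ∀ t ∈ Set.Icc (-Real.cos φ) (Real.cos θ), f t ≤ 0) (hC : IsCode θ (sphere 0 1) C)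
    (hx : x ∈ C) : ∑ y ∈ C, f (inner ℝ x y) ≤ hMax n θ φ f := by
  obtain ⟨Y, hY, hHY⟩ := exists_isCode_cap_H_eq hn hC (hC.norm_eq_one hx) φ f
  calc ∑ y ∈ C, f (inner ℝ x y)
      ≤ f 1 + ∑ y ∈ C with inner ℝ x y < -Real.cos φ, f (inner ℝ x y) :=
        sum_inner_le_add_sum_filter hθ.le (neg_le.1 (Real.neg_one_le_cos φ)) hneg hC hx
    _ = H n f Y := hHY.symm
    _ ≤ hMax n θ φ f := H_le_hMax hn hθ hf hY

theorem card_le_hMax_div {a : ℕ → ℝ} (hn : 2 ≤ n) (hθ : 0 < θ) (ha : ∀ k, 0 ≤ a k) (ha₀ : 0 < a 0)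
    (hf : ∀ t ∈ Set.Icc (-1 : ℝ) 1, HasSum (fun k => a k * (gegenbauer n k).eval t) (f t))
    (hneg : ∀ t ∈ Set.Icc (-Real.cos φ) (Real.cos θ), f t ≤ 0) (hC : IsCode θ (sphere 0 1) C) :
    (C.card : ℝ) ≤ hMax n θ φ f / a 0 := by
  have hn₀ : n ≠ 0 := by omega
  have hcont := continuousOn_of_hasSum_gegenbauer hn ha hf
  rw [le_div_iff₀' ha₀]
  rcases C.eq_empty_or_nonempty with rfl | hne
  · have hf₁ : 0 ≤ f 1 := (hf 1 (by norm_num)).nonneg fun k => by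
      simpa [gegenbauer_eval_one n hn] using ha k
    have hH := H_le_hMax (φ := φ) hn₀ hθ hcont isCode_empty
    rw [H, Finset.sum_empty, add_zero] at hH
    simpa using hf₁.trans hH
  · have henergy : a 0 * (C.card : ℝ) ^ 2 ≤ C.card * hMax n θ φ f :=
      calc a 0 * (C.card : ℝ) ^ 2 ≤ ∑ x ∈ C, ∑ y ∈ C, f (inner ℝ x y) :=
            mul_card_sq_le_sum_inner hn ha hf fun _ => hC.norm_eq_one
        _ ≤ ∑ _x ∈ C, hMax n θ φ f :=
            Finset.sum_le_sum fun x hx => sum_inner_le_hMax hn₀ hθ hcont hneg hC hx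
        _ = C.card * hMax n θ φ f := by rw [Finset.sum_const, nsmul_eq_mul]
    have hcard : (0 : ℝ) < C.card := by exact_mod_cast hne.card_pos
    exact le_of_mul_le_mul_left (by linarith) hcard

end Bound

end CapCodes

open CapCodes in
theorem theorem2_general (n : ℕ) (hn : 2 ≤ n) (θ φ : ℝ) (hθ : 0 < θ) (f : ℝ → ℝ) (a : ℕ → ℝ)
    (ha : ∀ k, 0 ≤ a k) (ha₀ : 0 < a 0)
    (hf : ∀ t ∈ Set.Icc (-1 : ℝ) 1, HasSum (fun k => a k * (gegenbauer n k).eval t) (f t))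
    (hneg : ∀ t ∈ Set.Icc (-Real.cos φ) (Real.cos θ), f t ≤ 0) :
    IsGreatest (codeSizes θ (Metric.sphere (0 : EuclideanSpace ℝ (Fin n)) 1))
      (maxSphericalCode n θ) ∧
    IsGreatest (codeSizes θ (cap n φ)) (maxCapCode n θ φ) ∧
    (∀ m ≤ maxCapCode n θ φ, IsGreatest (hValues n θ φ f m) (h n θ φ f m)) ∧
    (maxSphericalCode n θ : ℝ) ≤ hMax n θ φ f / a 0 := by
  have hsphere : IsGreatest (codeSizes θ (Metric.sphere (0 : EuclideanSpace ℝ (Fin n)) 1))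
      (maxSphericalCode n θ) := isGreatest_codeSizes hθ subset_rfl
  have hcont := continuousOn_of_hasSum_gegenbauer hn ha hf
  refine ⟨hsphere, isGreatest_codeSizes hθ cap_subset_sphere,
    fun m hm => isGreatest_hValues (by omega) hθ hcont hm, ?_⟩
  obtain ⟨C, hC, hcard⟩ := hsphere.1
  exact hcard ▸ card_le_hMax_div hn hθ ha ha₀ hf hneg hC

theorem theorem2 (n : ℕ) (hn : 2 ≤ n) (θ φ : ℝ) (hθ : 0 < θ) (hφ₀ : 0 ≤ φ)
    (hφ : φ ≤ Real.pi / 2) (f : ℝ → ℝ) (a : ℕ → ℝ) (ha : ∀ k, 0 ≤ a k) (ha₀ : 0 < a 0)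
    (hf : ∀ t ∈ Set.Icc (-1 : ℝ) 1,
      HasSum (fun k => a k * (CapCodes.gegenbauer n k).eval t) (f t))
    (hneg : ∀ t ∈ Set.Icc (-Real.cos φ) (Real.cos θ), f t ≤ 0) :
    -- the maxima in the definitions of `A(n, θ)`, `A(n, θ, φ)` and `h_m` are attained
    IsGreatest (CapCodes.codeSizes θ (Metric.sphere (0 : EuclideanSpace ℝ (Fin n)) 1))
      (CapCodes.maxSphericalCode n θ) ∧
    IsGreatest (CapCodes.codeSizes θ (CapCodes.cap n φ)) (CapCodes.maxCapCode n θ φ) ∧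
    (∀ m ≤ CapCodes.maxCapCode n θ φ,
      IsGreatest (CapCodes.hValues n θ φ f m) (CapCodes.h n θ φ f m)) ∧
    (CapCodes.maxSphericalCode n θ : ℝ) ≤ CapCodes.hMax n θ φ f / a 0 :=
  theorem2_general n hn θ φ hθ f a ha ha₀ hf hneg
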